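/- Let $F$ be an algebraically closed field of characteristic zero with infinite transcendence degree over $\mathbb{Q}$, and let $n\geq 1$ be an integer. Let ${\rm O}_n(F)=\{A\in{\rm GL}_n(F) : AA^T={\rm I}_n\}$. Then there exists a field automorphism $\varphi$ of $F$ (which may depend on $n$) such that the automorphism $\varphi_n$ of the group ${\rm O}_n(F)$ given by $\varphi_n((a_{i,j}))=(\varphi(a_{i,j}))$ has Reidemeister number $R(\varphi_n)=2$. Here the Reidemeister number $R(\psi)$ of an automorphism $\psi$ of a group $G$ is the number of equivalence classes of the relation on $G$ under which $x$ and $y$ are equivalent if and only if $x=zy\psi(z)^{-1}$ for some $z\in G$. -/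

import Mathlib

/-- The relation of `φ`-conjugation on a group `G`, for an automorphism `φ` of `G`:
`x` and `y` are `φ`-conjugated if `x = z * y * (φ z)⁻¹` for some `z` in `G`. -/
def twistedConjSetoid {G : Type*} [Group G] (φ : G ≃* G) : Setoid G where
  r x y := ∃ z : G, x = z * y * (φ z)⁻¹
  iseqv :=
    { refl := fun x => ⟨1, by simp⟩
      symm := by
        rintro x y ⟨z, rfl⟩
        exact ⟨z⁻¹, by simp [mul_assoc]⟩
      trans := by
        rintro x y w ⟨z, rfl⟩ ⟨z', rfl⟩
        exact ⟨z * z', by simp [mul_assoc]⟩ }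

/-- The Reidemeister number of an automorphism `φ` of a group `G`: the number of
`φ`-conjugacy classes, where all infinite cardinal numbers are written `⊤`. -/
noncomputable def reidemeisterNumber {G : Type*} [Group G] (φ : G ≃* G) : ℕ∞ :=
  ENat.card (Quotient (twistedConjSetoid φ))

/-- Applying a ring homomorphism to all entries preserves orthogonality of matrices. -/
theorem map_mem_orthogonalGroup {F : Type*} [CommRing F] {n : ℕ} (φ : F →+* F)
    {A : Matrix (Fin n) (Fin n) F} (hA : A ∈ Matrix.orthogonalGroup (Fin n) F) :
    A.map φ ∈ Matrix.orthogonalGroup (Fin n) F := by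
  rw [Matrix.mem_orthogonalGroup_iff] at hA ⊢
  rw [← Matrix.transpose_map, ← Matrix.map_mul, hA]
  exact Matrix.map_one φ (map_zero φ) (map_one φ)

/-- The automorphism of the orthogonal group `O_n(F)` (the `n × n` matrices `A` over `F` with
`A * Aᵀ = 1`) that is induced by an automorphism `φ` of `F`: it applies `φ` to every entry. -/
def orthogonalGroupAut {F : Type*} [CommRing F] (n : ℕ) (φ : F ≃+* F) :
    Matrix.orthogonalGroup (Fin n) F ≃* Matrix.orthogonalGroup (Fin n) F where
  toFun A := ⟨A.1.map φ, map_mem_orthogonalGroup (φ : F →+* F) A.2⟩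
  invFun A := ⟨A.1.map φ.symm, map_mem_orthogonalGroup (φ.symm : F →+* F) A.2⟩
  left_inv A := by
    ext i j
    simp
  right_inv A := by
    ext i j
    simp
  map_mul' A B := Subtype.ext (Matrix.map_mul (f := (φ : F →+* F)))

/-! Choose `φ`, trivial on the algebraic numbers, so that every system `φ(Z) = A Z` with `A`
invertible has an invertible solution. Such a `φ` comes from a transcendence basis cut into levels,
with one generic matrix per level and per `A`: `φ` multiplies that matrix by `A` once `A` is
algebraic over the lower levels. The new family is block triangular over the old one, hence again a
basis (`IsTranscendenceBasis.mul_blocks`), and the change of basis extends to `F`.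

For orthogonal `A`, solve `φ(Z) = Aᵀ Z`. The Gram matrix `Zᵀ Z` is fixed by `φ`, so it can be
diagonalized over the fixed field. Normalizing by square roots, which `φ` fixes or negates, reduces
`A` to a diagonal sign matrix (`exists_isSignedFrame`). A rotation negated by `φ` cancels signs in
pairs (`IsSignedFrame.erase_pair`), so at most one remains. The determinant separates the two
surviving classes. -/

/-! ### Algebraic independence and automorphisms from transcendence bases. -/

open MvPolynomial in
/-- Two transcendence bases of an algebraically closed field that are indexed by the same type are
matched by an automorphism over the base ring. -/
theorem IsTranscendenceBasis.exists_algEquiv {k F ι : Type*} [Field k] [Field F] [Algebra k F]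
    [IsAlgClosed F] {x y : ι → F} (hx : IsTranscendenceBasis k x)
    (hy : IsTranscendenceBasis k y) : ∃ φ : F ≃ₐ[k] F, ∀ i, φ (x i) = y i := by
  let := IsAlgClosed.isAlgClosure_of_transcendence_basis x hx
  let := IsAlgClosed.isAlgClosure_of_transcendence_basis y hy
  let e : Algebra.adjoin k (Set.range x) ≃ₐ[k] Algebra.adjoin k (Set.range y) :=
    hx.1.aevalEquiv.symm.trans hy.1.aevalEquiv
  let φ : F ≃+* F := IsAlgClosure.equivOfEquiv F F e.toRingEquiv
  have hφ : ∀ a : Algebra.adjoin k (Set.range x), φ a = e a := fun a =>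
    IsAlgClosure.equivOfEquiv_algebraMap F F e.toRingEquiv a
  refine ⟨AlgEquiv.ofRingEquiv (f := φ) fun r => ?_, fun i => ?_⟩
  · have := hφ (algebraMap k _ r)
    rwa [e.commutes] at this
  · have hi : x i = (hx.1.aevalEquiv (X i) : Algebra.adjoin k (Set.range x)) := by simp
    have := hφ (hx.1.aevalEquiv (X i))
    rw [← hi] at this
    simpa [e] using this

open MvPolynomial in
/-- An invertible polynomial substitution preserves algebraic independence. -/
theorem AlgebraicIndependent.of_substitution {R A ι : Type*} [CommRing R] [CommRing A]
    [Algebra R A] {x y : ι → A} (hx : AlgebraicIndependent R x) (s t : ι → MvPolynomial ι R)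
    (hy : ∀ i, y i = aeval x (s i)) (hst : ∀ i, aeval t (s i) = X i) :
    AlgebraicIndependent R y := by
  have hcomp : (aeval y : MvPolynomial ι R →ₐ[R] A) = (aeval x).comp (aeval s) := by
    ext i
    simp [hy]
  have hinv : ((aeval t).comp (aeval s) : MvPolynomial ι R →ₐ[R] _) = AlgHom.id R _ := by
    ext1 i
    rw [AlgHom.comp_apply, aeval_X, hst, AlgHom.id_apply]
  change Function.Injective (aeval y)
  rw [hcomp]
  have hs : Function.Injective (aeval s : MvPolynomial ι R →ₐ[R] _) :=
    fun p q hpq => by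
      have hp := DFunLike.congr_fun hinv p
      have hq := DFunLike.congr_fun hinv q
      simp only [AlgHom.comp_apply, AlgHom.id_apply] at hp hq
      rw [← hp, ← hq, hpq]
  exact Function.Injective.comp (g := aeval x) hx hs

open MvPolynomial in
/-- A family graded by `ℕ` is algebraically independent if all its truncations are. -/
theorem algebraicIndependent_of_truncations {R A ι : Type*} [CommRing R] [CommRing A]
    [Algebra R A] {y : ι → A} (d : ι → ℕ)
    (h : ∀ m, AlgebraicIndependent R fun p : {p : ι // d p < m} => y p) :
    AlgebraicIndependent R y := by
  change Function.Injective (aeval y)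
  rw [injective_iff_map_eq_zero]
  intro f hf
  classical
  -- A relation involves finitely many variables; the `+ 1` turns their largest degree into a strict
  -- bound.
  obtain ⟨g, hg⟩ := exists_rename_eq_of_vars_subset_range f
    (Subtype.val : {p : ι // d p < f.vars.sup d + 1} → ι) Subtype.val_injective
    (fun p hp => ⟨⟨p, Nat.lt_succ_of_le (Finset.le_sup (f := d) hp)⟩, rfl⟩)
  have h0 : Function.Injective (aeval fun p : {p : ι // d p < f.vars.sup d + 1} => y p) :=
    h (f.vars.sup d + 1)
  rw [← hg, aeval_rename] at hf
  rw [← hg, (injective_iff_map_eq_zero _).1 h0 g hf, map_zero]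

/-! ### Algebraic dependence as a matroid closure. -/

section RelativeAlgebraicClosure

variable {k F : Type*} [Field k] [Field F] [Algebra k F]

theorem isAlgebraic_adjoin_mono {S T : Set F} (hST : S ⊆ T) {a : F}
    (ha : IsAlgebraic (Algebra.adjoin k S) a) : IsAlgebraic (Algebra.adjoin k T) a := by
  have h := (AlgebraicIndependent.matroid k F).closure_subset_closure hST
  rw [AlgebraicIndependent.matroid_closure_eq, AlgebraicIndependent.matroid_closure_eq] at h
  exact (Subalgebra.mem_algebraicClosure _ _).1 (h ((Subalgebra.mem_algebraicClosure _ _).2 ha))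

theorem isAlgebraic_adjoin_trans {S T : Set F}
    (hST : ∀ s ∈ S, IsAlgebraic (Algebra.adjoin k T) s) {a : F}
    (ha : IsAlgebraic (Algebra.adjoin k S) a) : IsAlgebraic (Algebra.adjoin k T) a := by
  have h := (AlgebraicIndependent.matroid k F).closure_subset_closure_of_subset_closure
    (X := S) (Y := T)
  rw [AlgebraicIndependent.matroid_closure_eq, AlgebraicIndependent.matroid_closure_eq] at h
  exact (Subalgebra.mem_algebraicClosure _ _).1
    (h (fun s hs => (Subalgebra.mem_algebraicClosure _ _).2 (hST s hs))
      ((Subalgebra.mem_algebraicClosure _ _).2 ha))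

end RelativeAlgebraicClosure

/-! ### Block triangular changes of transcendence basis. -/

/-- Let a transcendence basis `x` be cut into levels `m : ℕ` and each level into square matrices
`x (m, c, ·, ·)`. Multiplying each matrix of level `m` by an invertible matrix with entries
algebraic over the lower levels gives a transcendence basis again. -/
theorem IsTranscendenceBasis.mul_blocks {k F J ν : Type*} [Field k] [Field F] [Algebra k F]
    [Fintype ν] [DecidableEq ν] {x y : ℕ × J × ν × ν → F} (hx : IsTranscendenceBasis k x)
    (M N : ℕ → J → Matrix ν ν F) (hNM : ∀ m c, N m c * M m c = 1)
    (hM : ∀ m c i j, IsAlgebraic (Algebra.adjoin k (x '' (Prod.fst ⁻¹' Set.Iio m))) (M m c i j))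
    (hN : ∀ m c i j, IsAlgebraic (Algebra.adjoin k (x '' (Prod.fst ⁻¹' Set.Iio m))) (N m c i j))
    (hy : ∀ m c i j, y (m, c, i, j) = ∑ l, M m c i l * x (m, c, l, j)) :
    IsTranscendenceBasis k y := by
  have hMN : ∀ m c, M m c * N m c = 1 := fun m c => mul_eq_one_comm.1 (hNM m c)
  have hxy : ∀ m c i j, x (m, c, i, j) = ∑ l, N m c i l * y (m, c, l, j) := by
    intro m c i j
    have h : (Matrix.of fun i j => y (m, c, i, j)) =
        M m c * Matrix.of fun i j => x (m, c, i, j) := by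
      ext i j
      simp [Matrix.mul_apply, hy]
    have h' : N m c * Matrix.of (fun i j => y (m, c, i, j)) =
        Matrix.of fun i j => x (m, c, i, j) := by
      rw [h, ← Matrix.mul_assoc, hNM, one_mul]
    simpa [Matrix.mul_apply] using (congrFun₂ h' i j).symm
  have hTmono : ∀ {m' m}, m' ≤ m →
      x '' (Prod.fst ⁻¹' Set.Iio m') ⊆ x '' (Prod.fst ⁻¹' Set.Iio m) := fun h =>
    Set.image_mono (Set.preimage_mono (Set.Iio_subset_Iio h))
  have step : ∀ m, AlgebraicIndependent k
      fun p : {p : ℕ × J × ν × ν // p.1 < m} => y p := by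
    intro m
    induction m with
    | zero =>
      have : IsEmpty {p : ℕ × J × ν × ν // p.1 < 0} := ⟨fun p => by simpa using p.2⟩
      rw [algebraicIndependent_empty_type_iff]
      exact (algebraMap k F).injective
    | succ m ih =>
      -- Over `E` the entries of `M m c` and `N m c` are constants, so passing from `x` to `y` on
      -- level `m` is an invertible linear substitution.
      let E := Subalgebra.algebraicClosure (Algebra.adjoin k (x '' (Prod.fst ⁻¹' Set.Iio m))) F
      have memE : ∀ {a : F}, a ∈ E ↔ IsAlgebraic (Algebra.adjoin k (x '' (Prod.fst ⁻¹' Set.Iio m))) a :=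
        Subalgebra.mem_algebraicClosure _ _
      have hxE : AlgebraicIndependent E fun q : J × ν × ν => x (m, q) := by
        have hdisj : Disjoint (Prod.fst ⁻¹' Set.Iio m : Set (ℕ × J × ν × ν)) (Prod.fst ⁻¹' {m}) :=
          Disjoint.preimage _ (by simp)
        have h := (hx.1.adjoin_of_disjoint hdisj).subalgebraAlgebraicClosure
        exact h.comp (fun q => ⟨(m, q), rfl⟩) fun q q' hq =>
          (Prod.ext_iff.1 (Subtype.ext_iff.1 hq)).2
      have hyE : AlgebraicIndependent E fun q : J × ν × ν => y (m, q) := by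
        refine hxE.of_substitution
          (fun q => ∑ l, MvPolynomial.C (⟨M m q.1 q.2.1 l, memE.2 (hM ..)⟩ : E) *
            MvPolynomial.X (q.1, l, q.2.2))
          (fun q => ∑ l, MvPolynomial.C (⟨N m q.1 q.2.1 l, memE.2 (hN ..)⟩ : E) *
            MvPolynomial.X (q.1, l, q.2.2)) ?_ ?_
        · rintro ⟨c, i, j⟩
          simp only [hy, map_sum, map_mul, MvPolynomial.aeval_X, MvPolynomial.algHom_C]
          rfl
        · rintro ⟨c, i, j⟩
          simp only [map_sum, map_mul, MvPolynomial.aeval_X, MvPolynomial.algHom_C,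
            MvPolynomial.algebraMap_eq, Finset.mul_sum]
          rw [Finset.sum_comm]
          have hone : ∀ l, ∑ a, MvPolynomial.C (σ := J × ν × ν)
              (⟨M m c i a, memE.2 (hM ..)⟩ : E) * MvPolynomial.C ⟨N m c a l, memE.2 (hN ..)⟩ =
              if i = l then 1 else 0 := by
            intro l
            have : ∑ a, (⟨M m c i a, memE.2 (hM ..)⟩ : E) * ⟨N m c a l, memE.2 (hN ..)⟩ =
                if i = l then 1 else 0 := by
              apply Subtype.ext
              have := congrFun₂ (hMN m c) i l
              rw [Matrix.mul_apply, Matrix.one_apply] at this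
              rw [AddSubmonoidClass.coe_finsetSum]
              split_ifs with h <;> simpa [h] using this
            simp only [← map_mul, ← map_sum, this]
            split_ifs <;> simp
          simp only [← mul_assoc, ← Finset.sum_mul, hone]
          simp
      have hrange : Set.range (fun p : {p : ℕ × J × ν × ν // p.1 < m} => y p) ⊆
          Set.range (algebraMap E F) := by
        rintro _ ⟨⟨⟨m', c, i, j⟩, hp⟩, rfl⟩
        have hp' : m' < m := hp
        have : y (m', c, i, j) ∈ E := by
          rw [hy]
          refine sum_mem fun l _ => mul_mem (memE.2 ?_) (memE.2 ?_)
          · exact isAlgebraic_adjoin_mono (hTmono hp'.le) (hM ..)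
          · exact isAlgebraic_algebraMap (⟨_, Algebra.subset_adjoin ⟨_, hp', rfl⟩⟩ :
              Algebra.adjoin k (x '' (Prod.fst ⁻¹' Set.Iio m)))
        exact ⟨⟨_, this⟩, rfl⟩
      have h := ih.sumElim_of_tower hrange hyE
      let e : {p : ℕ × J × ν × ν // p.1 < m + 1} → (J × ν × ν) ⊕ {p : ℕ × J × ν × ν // p.1 < m} :=
        fun p => if hp : p.1.1 < m then Sum.inr ⟨p.1, hp⟩ else Sum.inl p.1.2
      have he : ∀ p, Sum.elim (fun q => y (m, q)) (fun p : {p : ℕ × J × ν × ν // p.1 < m} => y p)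
          (e p) = y p := by
        rintro ⟨⟨m', q⟩, hp⟩
        have hp' : m' < m + 1 := hp
        by_cases h : m' < m
        · simp [e, h]
        · obtain rfl : m' = m := by omega
          simp [e]
      have hinj : Function.Injective e := by
        rintro ⟨⟨m₁, q₁⟩, h₁⟩ ⟨⟨m₂, q₂⟩, h₂⟩ h
        simp only [e] at h h₁ h₂
        split_ifs at h with a b b
        · simpa using h
        · simp only [Sum.inl.injEq] at h
          simp only [Subtype.mk.injEq, Prod.mk.injEq]
          exact ⟨by omega, h⟩
      have h' := h.comp e hinj
      convert h' using 1
      ext p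
      exact (he p).symm
  have hind := algebraicIndependent_of_truncations Prod.fst step
  rw [hind.isTranscendenceBasis_iff_isAlgebraic, hx.isAlgebraic_iff]
  -- By induction on the level: the entries of `N` are algebraic over lower `x`, hence over `y`, and
  -- `x = N y`.
  have key : ∀ m c i j, IsAlgebraic (Algebra.adjoin k (Set.range y)) (x (m, c, i, j)) := by
    intro m
    induction m using Nat.strong_induction_on with
    | _ m ih =>
      intro c i j
      have memE : ∀ {a : F}, a ∈ Subalgebra.algebraicClosure (Algebra.adjoin k (Set.range y)) F ↔
          IsAlgebraic (Algebra.adjoin k (Set.range y)) a :=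
        Subalgebra.mem_algebraicClosure _ _
      rw [hxy, ← memE]
      refine sum_mem fun l _ => mul_mem (memE.2 ?_) (memE.2 ?_)
      · refine isAlgebraic_adjoin_trans ?_ (hN m c i l)
        rintro _ ⟨⟨m', c', i', j'⟩, h, rfl⟩
        exact ih m' h c' i' j'
      · exact isAlgebraic_algebraMap (⟨_, Algebra.subset_adjoin ⟨_, rfl⟩⟩ :
          Algebra.adjoin k (Set.range y))
  rintro ⟨m, c, i, j⟩
  exact key m c i j

/-- Algebraic dependence is finitary, and a finite part of the family has bounded degree. -/
theorem exists_isAlgebraic_adjoin_truncation {k F ι : Type*} [Field k] [Field F] [Algebra k F]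
    (x : ι → F) (d : ι → ℕ) {a : F} (ha : IsAlgebraic (Algebra.adjoin k (Set.range x)) a) :
    ∃ m, IsAlgebraic (Algebra.adjoin k (x '' (d ⁻¹' Set.Iio m))) a := by
  have h : a ∈ (AlgebraicIndependent.matroid k F).closure (Set.range x) := by
    rw [AlgebraicIndependent.matroid_closure_eq]
    exact (Subalgebra.mem_algebraicClosure _ _).2 ha
  obtain ⟨I, hI, hfin, -, haI⟩ := (AlgebraicIndependent.matroid k F).exists_mem_finite_closure_of_mem_closure h
  rw [AlgebraicIndependent.matroid_closure_eq] at haI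
  obtain ⟨t, ht, rfl⟩ : ∃ t : Set ι, t.Finite ∧ x '' t = I := by
    obtain ⟨t, -, h1, h2⟩ := (Set.exists_subset_image_finite_and (s := Set.univ)
      (p := (· = I))).1 ⟨I, by simpa using hI, hfin, rfl⟩
    exact ⟨t, h1, h2⟩
  obtain ⟨m, hm⟩ := (ht.image d).bddAbove
  refine ⟨m + 1, isAlgebraic_adjoin_mono (Set.image_mono fun i hi => ?_)
    ((Subalgebra.mem_algebraicClosure _ _).1 haI)⟩
  exact Nat.lt_succ_of_le (hm ⟨i, hi, rfl⟩)

/-! ### The automorphism solving linear difference systems. -/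

/-- Over an algebraically closed field of characteristic zero and infinite transcendence degree
there is an automorphism `φ`, trivial on the algebraic numbers, for which every linear difference
system `φ(Z) = A Z` of a given size has an invertible solution. -/
theorem exists_algEquiv_solving_linear_systems {F : Type*} [Field F] [IsAlgClosed F] [CharZero F]
    (hF : Cardinal.aleph0 ≤ Algebra.trdeg ℚ F) (n : ℕ) (hn : 1 ≤ n) :
    ∃ φ : F ≃ₐ[algebraicClosure ℚ F] F, ∀ A : Matrix (Fin n) (Fin n) F, IsUnit A.det →
      ∃ Z : Matrix (Fin n) (Fin n) F, IsUnit Z.det ∧ Z.map φ = A * Z := by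
  classical
  obtain ⟨s, hs⟩ := exists_isTranscendenceBasis ℚ F
  -- A basis as large as `F` leaves room for a block for each matrix over `F` on every level.
  have hcard : Cardinal.mk s = Cardinal.mk F := by
    have hs_inf : Cardinal.aleph0 ≤ Cardinal.mk s := by rwa [hs.cardinalMk_eq_trdeg]
    refine le_antisymm (Cardinal.mk_set_le s) ?_
    have h := IsAlgClosed.cardinal_le_max_transcendence_basis _ hs
    simpa [hs_inf] using h
  have hinf : Cardinal.aleph0 ≤ Cardinal.mk F := Cardinal.infinite_iff.1 inferInstance
  have hidx : Cardinal.mk s =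
      Cardinal.mk (ℕ × Matrix (Fin n) (Fin n) F × Fin n × Fin n) := by
    have hmat : Cardinal.mk (Matrix (Fin n) (Fin n) F) = Cardinal.mk F := by
      have : Cardinal.mk (Matrix (Fin n) (Fin n) F) = (Cardinal.mk F ^ n) ^ n := by
        simp [Matrix]
      rw [this, Cardinal.power_nat_eq hinf hn, Cardinal.power_nat_eq hinf hn]
    have hn0 : (n : Cardinal) ≠ 0 := by exact_mod_cast (by omega : n ≠ 0)
    have hnF : (n : Cardinal) ≤ Cardinal.mk F := (Cardinal.natCast_lt_aleph0.le).trans hinf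
    have hsq : Cardinal.mk F * ((n : Cardinal) * n) = Cardinal.mk F := by
      rw [← mul_assoc, Cardinal.mul_eq_left hinf hnF hn0, Cardinal.mul_eq_left hinf hnF hn0]
    rw [hcard]
    simp [Cardinal.mk_prod, hmat, hsq, Cardinal.aleph0_mul_eq hinf]
  obtain ⟨e⟩ := Cardinal.eq.1 hidx
  let k := algebraicClosure ℚ F
  have : Algebra.IsAlgebraic ℚ k := algebraicClosure.isAlgebraic ℚ F
  let x : ℕ × Matrix (Fin n) (Fin n) F × Fin n × Fin n → F := fun p => (e.symm p : F)
  have hx : IsTranscendenceBasis k x :=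
    (Algebra.IsAlgebraic.isTranscendenceBasis_iff ℚ k).1 (hs.comp_equiv e.symm)
  let good : ℕ → Matrix (Fin n) (Fin n) F → Prop := fun m A => A⁻¹ * A = 1 ∧
    (∀ i j, IsAlgebraic (Algebra.adjoin k (x '' (Prod.fst ⁻¹' Set.Iio m))) (A i j)) ∧
    ∀ i j, IsAlgebraic (Algebra.adjoin k (x '' (Prod.fst ⁻¹' Set.Iio m))) (A⁻¹ i j)
  have hone : ∀ m, good m 1 := by
    have h : ∀ m (i j : Fin n), IsAlgebraic (Algebra.adjoin k (x '' (Prod.fst ⁻¹' Set.Iio m)))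
        ((1 : Matrix (Fin n) (Fin n) F) i j) := by
      intro m i j
      rw [Matrix.one_apply]
      split_ifs
      · exact isAlgebraic_one
      · exact isAlgebraic_zero
    exact fun m => ⟨by simp, h m, by simpa using h m⟩
  -- The default `1` keeps every block multiplier invertible; the block of `A` is read off only at a
  -- level where `A` is good.
  let M : ℕ → Matrix (Fin n) (Fin n) F → Matrix (Fin n) (Fin n) F :=
    fun m A => if good m A then A else 1
  have hM : ∀ m A, good m (M m A) := by
    intro m A
    by_cases h : good m A
    · simp [M, h]
    · simp [M, h, hone m]
  have hy := hx.mul_blocks (y := fun p => ∑ l, M p.1 p.2.1 p.2.2.1 l * x (p.1, p.2.1, l, p.2.2.2))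
    M (fun m A => (M m A)⁻¹) (fun m A => (hM m A).1) (fun m A => (hM m A).2.1)
    (fun m A => (hM m A).2.2) fun _ _ _ _ => rfl
  obtain ⟨φ, hφ⟩ := hx.exists_algEquiv hy
  refine ⟨φ, fun A hA => ?_⟩
  have halg : ∀ a : F, ∃ m, IsAlgebraic (Algebra.adjoin k (x '' (Prod.fst ⁻¹' Set.Iio m))) a :=
    fun a => exists_isAlgebraic_adjoin_truncation x Prod.fst (hx.isAlgebraic.isAlgebraic a)
  choose m hm using halg
  obtain ⟨m₀, hm₀⟩ : ∃ m₀, ∀ i j, m (A i j) ≤ m₀ ∧ m (A⁻¹ i j) ≤ m₀ := by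
    obtain ⟨m₀, h⟩ := (Set.finite_range fun p : Fin n × Fin n =>
      max (m (A p.1 p.2)) (m (A⁻¹ p.1 p.2))).bddAbove
    exact ⟨m₀, fun i j => max_le_iff.1 (h ⟨(i, j), rfl⟩)⟩
  have hmono : ∀ {m m'}, m ≤ m' → x '' (Prod.fst ⁻¹' Set.Iio m) ⊆ x '' (Prod.fst ⁻¹' Set.Iio m') :=
    fun h => Set.image_mono (Set.preimage_mono (Set.Iio_subset_Iio h))
  have hgood : good m₀ A := ⟨Matrix.nonsing_inv_mul _ hA,
    fun i j => isAlgebraic_adjoin_mono (hmono (hm₀ i j).1) (hm _),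
    fun i j => isAlgebraic_adjoin_mono (hmono (hm₀ i j).2) (hm _)⟩
  refine ⟨Matrix.of fun i j => x (m₀, A, i, j), ?_, ?_⟩
  -- The entries are independent, so the determinant vanishes only if the generic determinant
  -- polynomial does.
  · have hind : AlgebraicIndependent k fun q : Fin n × Fin n => x (m₀, A, q) :=
      hx.1.comp (fun q => (m₀, A, q)) fun q q' h => by simpa using h
    rw [isUnit_iff_ne_zero]
    intro h0
    refine Matrix.det_mvPolynomialX_ne_zero (Fin n) k
      ((injective_iff_map_eq_zero (MvPolynomial.aeval (R := k) fun q : Fin n × Fin n => x (m₀, A, q))).1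
        hind _ ?_)
    rw [AlgHom.map_det, ← h0]
    congr 1
    ext i j
    simp [Matrix.mvPolynomialX]
  · ext i j
    simp [hφ, Matrix.mul_apply, M, hgood]

/-! ### Orthonormal frames for the semilinear map `v ↦ A (φ v)`. -/

open Matrix

/-- An orthonormal frame `z` of `F ^ n` on which the `φ`-semilinear map `v ↦ A (φ v)` acts by signs,
`-1` exactly on the vectors with index in `s`. -/
def IsSignedFrame {F : Type*} [Field F] {n : ℕ} (φ : F ≃+* F) (A : Matrix (Fin n) (Fin n) F)
    (s : Finset (Fin n)) (z : Fin n → Fin n → F) : Prop :=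
  (∀ i j, z i ⬝ᵥ z j = if i = j then 1 else 0) ∧
    ∀ i, A *ᵥ (φ ∘ z i) = if i ∈ s then -z i else z i

section SignedFrame

variable {F : Type*} [Field F] {n : ℕ} {φ : F ≃+* F} {A : Matrix (Fin n) (Fin n) F}
  {s : Finset (Fin n)} {z : Fin n → Fin n → F}

theorem RingEquiv.comp_smul_add_smul (φ : F ≃+* F) (a b : F) (v w : Fin n → F) :
    φ ∘ (a • v + b • w) = φ a • (φ ∘ v) + φ b • (φ ∘ w) := by
  ext i
  simp

/-- Two minus signs of a signed frame are removed by a rotation on which `φ` acts as `-1`. -/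
theorem IsSignedFrame.erase_pair (hz : IsSignedFrame φ A s z) {p q : F} (hpq : p * p + q * q = 1)
    (hp : φ p = -p) (hq : φ q = -q) {i j : Fin n} (hij : i ≠ j) (hi : i ∈ s) (hj : j ∈ s) :
    ∃ z', IsSignedFrame φ A ((s.erase i).erase j) z' := by
  refine ⟨fun k => if k = i then p • z i + q • z j else
    if k = j then (-q) • z i + p • z j else z k, fun a b => ?_, fun a => ?_⟩
  · have h := hz.1
    have hpq' : q * q + p * p = 1 := by rw [add_comm, hpq]
    have hij' := hij.symm
    clear hz hp hq
    by_cases hai : a = i <;> by_cases haj : a = j <;> by_cases hbi : b = i <;>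
      by_cases hbj : b = j <;> simp_all [mul_comm, eq_comm]
  · have hi' := hz.2 i
    have hj' := hz.2 j
    rw [if_pos hi] at hi'
    rw [if_pos hj] at hj'
    by_cases hai : a = i
    · subst hai
      simp only [if_true, RingEquiv.comp_smul_add_smul, mulVec_add, mulVec_smul, hi', hj', hp, hq]
      simp
    · by_cases haj : a = j
      · subst haj
        simp only [if_true, RingEquiv.comp_smul_add_smul, mulVec_add, mulVec_smul, hi', hj', hp,
          hq, map_neg, if_neg hij.symm]
        simp
      · simp [hai, haj, hz.2 a]

/-- The vectors of a signed frame can be permuted. -/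
theorem IsSignedFrame.singleton_move {i : Fin n} (hz : IsSignedFrame φ A {i} z) (j : Fin n) :
    IsSignedFrame φ A {j} (z ∘ Equiv.swap i j) := by
  refine ⟨fun a b => ?_, fun a => ?_⟩
  · simp [hz.1]
  · have : Equiv.swap i j a = i ↔ a = j := by
      rw [← Equiv.eq_symm_apply]
      simp
    simp [hz.2, this]

/-- As long as two minus signs are left, `IsSignedFrame.erase_pair` shrinks `s`. -/
theorem IsSignedFrame.exists_card_le_one (hz : IsSignedFrame φ A s z) {p q : F}
    (hpq : p * p + q * q = 1) (hp : φ p = -p) (hq : φ q = -q) :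
    ∃ s' z', IsSignedFrame φ A s' z' ∧ s'.card ≤ 1 := by
  induction hs : s.card using Nat.strong_induction_on generalizing s z with
  | _ m ih =>
    by_cases h : s.card ≤ 1
    · exact ⟨s, z, hz, h⟩
    · obtain ⟨i, hi, j, hj, hij⟩ := Finset.one_lt_card.1 (not_le.1 h)
      obtain ⟨z', hz'⟩ := hz.erase_pair hpq hp hq hij hi hj
      refine ih _ ?_ hz' rfl
      rw [← hs]
      exact (Finset.card_erase_le).trans_lt (Finset.card_erase_lt_of_mem hi)

theorem LinearMap.BilinForm.exists_orthogonal_basis_fin {K : Type*} [Field K] [Invertible (2 : K)]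
    {B : LinearMap.BilinForm K (Fin n → K)} (hB : LinearMap.IsSymm B) :
    ∃ v : Module.Basis (Fin n) K (Fin n → K), LinearMap.IsOrthoᵢ B v := by
  obtain ⟨v, hv⟩ := LinearMap.BilinForm.exists_orthogonal_basis hB
  have h : Module.finrank K (Fin n → K) = n := by simp
  refine ⟨v.reindex (finCongr h), ?_⟩
  rw [LinearMap.isOrthoᵢ_def] at hv ⊢
  intro i j hij
  rw [Module.Basis.reindex_apply, Module.Basis.reindex_apply]
  exact hv _ _ ((finCongr h).symm.injective.ne hij)

/-- An orthogonal matrix `A` whose linear difference system `φ(Z) = A⁻¹ Z` has an invertible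
solution has a signed frame. -/
theorem exists_isSignedFrame [IsAlgClosed F] [CharZero F] (hA : A * Aᵀ = 1)
    {Z : Matrix (Fin n) (Fin n) F} (hZ : IsUnit Z.det) (hφ : Z.map φ = Aᵀ * Z) :
    ∃ s z, IsSignedFrame φ A s z := by
  let K : Subfield F := (φ : F →+* F).eqLocusField (RingHom.id F)
  have memK : ∀ {a}, a ∈ K ↔ φ a = a := Iff.rfl
  -- Applying `φ` gives `Zᵀ A Aᵀ Z`, and `A` is orthogonal.
  have hS : (Zᵀ * Z).map φ = Zᵀ * Z := by
    have h : (Zᵀ * Z).map φ = (Z.map φ)ᵀ * Z.map φ :=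
      Matrix.map_mul (f := (φ : F →+* F))
    rw [h, hφ, transpose_mul, transpose_transpose, Matrix.mul_assoc, ← Matrix.mul_assoc A, hA,
      Matrix.one_mul]
  let S : Matrix (Fin n) (Fin n) K :=
    Matrix.of fun i j => ⟨(Zᵀ * Z) i j, memK.2 (congrFun₂ hS i j)⟩
  have hSF : S.map K.subtype = Zᵀ * Z := by
    ext i j
    rfl
  have hdet : S.det ≠ 0 := by
    intro h
    have := RingHom.map_det K.subtype S
    rw [h, map_zero, RingHom.mapMatrix_apply, hSF, det_mul, det_transpose] at this
    exact hZ.ne_zero (by simpa using this.symm)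
  let B : LinearMap.BilinForm K (Fin n → K) := Matrix.toBilin' S
  have hBF : ∀ a b : Fin n → K,
      (Z *ᵥ (K.subtype ∘ a)) ⬝ᵥ (Z *ᵥ (K.subtype ∘ b)) = K.subtype (B a b) := by
    intro a b
    rw [Matrix.toBilin'_apply', RingHom.map_dotProduct]
    have : K.subtype ∘ (S *ᵥ b) = (Zᵀ * Z) *ᵥ (K.subtype ∘ b) := by
      ext i
      rw [Function.comp_apply, RingHom.map_mulVec, hSF]
    rw [this, ← mulVec_mulVec, dotProduct_mulVec _ Zᵀ, vecMul_transpose]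
  have hBsymm : LinearMap.IsSymm B := by
    refine ⟨fun a b => Subtype.ext ?_⟩
    change K.subtype (B a b) = K.subtype (B b a)
    rw [← hBF, ← hBF, dotProduct_comm]
  have : Invertible (2 : K) := invertibleOfNonzero two_ne_zero
  obtain ⟨v, hv⟩ := LinearMap.BilinForm.exists_orthogonal_basis_fin hBsymm
  have hB : B.SeparatingLeft := (Matrix.nondegenerate_of_det_ne_zero hdet).toBilin'.1
  let w : Fin n → Fin n → F := fun i => Z *ᵥ (K.subtype ∘ v i)
  have hw : ∀ i j, w i ⬝ᵥ w j = B (v i) (v j) := fun i j => hBF (v i) (v j)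
  have hφw : ∀ i, φ ∘ w i = Aᵀ *ᵥ w i := by
    intro i
    have hfix : φ ∘ (K.subtype ∘ v i) = K.subtype ∘ v i := by
      ext k
      exact memK.1 (v i k).2
    rw [mulVec_mulVec, ← hφ]
    ext k
    have h := RingHom.map_mulVec (φ : F →+* F) Z (K.subtype ∘ v i) k
    exact h.trans (congrArg (fun u => (Z.map φ *ᵥ u) k) hfix)
  -- The squared lengths lie in `K` but their roots `r i` need not: this is where the signs arise.
  choose r hr using fun i => IsAlgClosed.exists_eq_mul_self (w i ⬝ᵥ w i)
  have hr0 : ∀ i, r i ≠ 0 := by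
    intro i h
    have h1 := hr i
    rw [h, mul_zero, hw] at h1
    exact hv.not_isOrtho_basis_self_of_separatingLeft hB i (by simpa using h1)
  have hφr : ∀ i, φ (r i) = r i ∨ φ (r i) = -r i := by
    intro i
    rw [← mul_self_eq_mul_self_iff, ← map_mul, ← hr, hw]
    exact memK.1 (B (v i) (v i)).2
  classical
  refine ⟨Finset.univ.filter fun i => φ (r i) = - r i, fun i => (r i)⁻¹ • w i, fun i j => ?_,
    fun i => ?_⟩
  · rw [smul_dotProduct, dotProduct_smul]
    split_ifs with hij
    · subst hij
      rw [hr]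
      have := hr0 i
      simp only [smul_eq_mul]
      field_simp
    · have : w i ⬝ᵥ w j = 0 := by
        rw [hw]
        exact_mod_cast hv hij
      simp [this]
  · have h : φ ∘ ((r i)⁻¹ • w i) = (φ (r i))⁻¹ • (φ ∘ w i) := by
      ext k
      simp
    have hAw : A *ᵥ (φ ∘ w i) = w i := by rw [hφw, mulVec_mulVec, hA, one_mulVec]
    rw [h, mulVec_smul, hAw]
    split_ifs with hs
    · rw [(Finset.mem_filter.1 hs).2, inv_neg, neg_smul]
    · rw [(hφr i).resolve_right fun h => hs (by simpa using h)]

end SignedFrame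

/-! ### Sign matrices and the count of classes. -/

/-- The diagonal matrix with entries `-1` exactly at the indices in `s`. -/
def signDiagonal (F : Type*) [Field F] {n : ℕ} (s : Finset (Fin n)) :
    Matrix.orthogonalGroup (Fin n) F :=
  ⟨Matrix.diagonal fun i => if i ∈ s then -1 else 1, by
    rw [Matrix.mem_orthogonalGroup_iff, 
      diagonal_transpose, diagonal_mul_diagonal, ← diagonal_one]
    congr 1
    ext i
    split_ifs <;> simp⟩

/-- With the frame as columns of `Z`, the sign condition reads `A φ(Z) = Z D`, where `D` is the sign
matrix. -/
theorem IsSignedFrame.twistedConj {F : Type*} [Field F] {n : ℕ} {φ : F ≃+* F}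
    {A : Matrix.orthogonalGroup (Fin n) F} {s : Finset (Fin n)} {z : Fin n → Fin n → F}
    (hz : IsSignedFrame φ (A : Matrix (Fin n) (Fin n) F) s z) :
    twistedConjSetoid (orthogonalGroupAut n φ) A (signDiagonal F s) := by
  let Z : Matrix.orthogonalGroup (Fin n) F := ⟨(Matrix.of z)ᵀ, by
    rw [Matrix.mem_orthogonalGroup_iff']
    ext i j
    simpa [mul_apply, dotProduct, one_apply] using hz.1 i j⟩
  refine ⟨Z, ?_⟩
  rw [eq_mul_inv_iff_mul_eq]
  apply Subtype.ext
  ext i j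
  have h := congrFun (hz.2 j) i
  have h2 : (A.1 * (orthogonalGroupAut n φ Z).1) i j = (A.1 *ᵥ (φ ∘ z j)) i := rfl
  refine h2.trans (h.trans ?_)
  change _ = (Z.1 * diagonal _ : Matrix (Fin n) (Fin n) F) i j
  rw [mul_diagonal]
  split_ifs <;> simp [Z]

/-- The conjugating matrix has determinant `1` or `-1`, which `φ` fixes, so it cancels. -/
theorem det_eq_of_twistedConj {F : Type*} [Field F] {n : ℕ} {φ : F ≃+* F}
    {A B : Matrix.orthogonalGroup (Fin n) F}
    (h : twistedConjSetoid (orthogonalGroupAut n φ) A B) : A.1.det = B.1.det := by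
  obtain ⟨Z, hZ⟩ := h
  rw [eq_mul_inv_iff_mul_eq] at hZ
  have h1 : A.1.det * φ Z.1.det = Z.1.det * B.1.det := by
    have h2 := congrArg (fun M => M.1.det) hZ
    have h3 : (orthogonalGroupAut n φ Z).1.det = φ Z.1.det := (RingHom.map_det (φ : F →+* F) Z.1).symm
    simpa [h3] using h2
  have hZZ : Z.1.det * Z.1.det = 1 := by
    have h2 := congrArg Matrix.det ((Matrix.mem_orthogonalGroup_iff _ _).1 Z.2)
    rwa [det_mul, det_transpose,
      det_one] at h2
  rcases mul_self_eq_one_iff.1 hZZ with h | h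
  · simpa [h] using h1
  · simpa [h] using h1

theorem theorem3 {F : Type*} [Field F] [IsAlgClosed F] [CharZero F]
    (hF : Cardinal.aleph0 ≤ Algebra.trdeg ℚ F) (n : ℕ) (hn : 1 ≤ n) :
    ∃ φ : F ≃+* F, reidemeisterNumber (orthogonalGroupAut n φ) = 2 := by
  obtain ⟨ψ, hψ⟩ := exists_algEquiv_solving_linear_systems hF n hn
  let φ : F ≃+* F := ψ
  let o : Fin n := ⟨0, hn⟩
  have hD : (signDiagonal F {o}).1.det = -1 := by
    simp [signDiagonal, det_diagonal, Finset.prod_ite_eq']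
  obtain ⟨I, hI⟩ := IsAlgClosed.exists_eq_mul_self (-1 : F)
  have hφI : φ I = I := by
    have hmem : I ∈ algebraicClosure ℚ F := by
      rw [mem_algebraicClosure_iff]
      refine IsAlgebraic.of_pow (n := 2) two_pos ?_
      rw [sq, ← hI]
      exact isAlgebraic_one.neg
    exact ψ.commutes ⟨I, hmem⟩
  -- Taking determinants in `φ(Z) = D Z` with `det D = -1` shows that `u = det Z` works.
  obtain ⟨u, hu0, hu⟩ : ∃ u : F, u ≠ 0 ∧ φ u = -u := by
    obtain ⟨Z, hZ, hφZ⟩ := hψ (signDiagonal F {o}).1 (by simp [hD])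
    refine ⟨Z.det, hZ.ne_zero, ?_⟩
    have h : φ Z.det = (Z.map φ).det := RingHom.map_det (φ : F →+* F) Z
    rw [h]
    refine (congrArg det hφZ).trans ?_
    rw [det_mul, hD, neg_one_mul]
  -- Here `p` and `q` are chosen so that `p + I q = u` and `p - I q = u⁻¹`; as `φ` fixes `I` and
  -- negates `u`, it negates both.
  have hpq : ((u⁻¹ + u) / 2) * ((u⁻¹ + u) / 2) + (I * (u⁻¹ - u) / 2) * (I * (u⁻¹ - u) / 2) = 1 := by
    have : (I * (u⁻¹ - u) / 2) * (I * (u⁻¹ - u) / 2) = -((u⁻¹ - u) / 2) ^ 2 := by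
      linear_combination (-((u⁻¹ - u) / 2) ^ 2) * hI
    rw [this]
    field_simp
    ring
  have hp : φ ((u⁻¹ + u) / 2) = -((u⁻¹ + u) / 2) := by
    simp only [map_div₀, map_add, map_inv₀, hu, map_ofNat, inv_neg]
    ring
  have hq : φ (I * (u⁻¹ - u) / 2) = -(I * (u⁻¹ - u) / 2) := by
    simp only [map_div₀, map_mul, map_sub, map_inv₀, hu, hφI, map_ofNat, inv_neg]
    ring
  have hclass : ∀ A : Matrix.orthogonalGroup (Fin n) F,
      twistedConjSetoid (orthogonalGroupAut n φ) A 1 ∨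
        twistedConjSetoid (orthogonalGroupAut n φ) A (signDiagonal F {o}) := by
    intro A
    have hA : A.1 * A.1ᵀ = 1 := by
      simpa [star_eq_conjTranspose] using (Matrix.mem_orthogonalGroup_iff _ _).1 A.2
    have hdet : IsUnit (A.1ᵀ).det := by
      rw [det_transpose]
      exact isUnit_det_of_right_inverse hA
    obtain ⟨Z, hZ, hφZ⟩ := hψ _ hdet
    obtain ⟨s, z, hz⟩ := exists_isSignedFrame (φ := φ) hA hZ hφZ
    obtain ⟨s', z', hz', hs'⟩ := hz.exists_card_le_one hpq hp hq
    rcases Nat.le_one_iff_eq_zero_or_eq_one.1 hs' with h | h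
    · left
      have hone : signDiagonal F (∅ : Finset (Fin n)) = 1 := by
        apply Subtype.ext
        simp [signDiagonal]
      rw [Finset.card_eq_zero.1 h] at hz'
      exact hone ▸ hz'.twistedConj
    · right
      obtain ⟨i, rfl⟩ := Finset.card_eq_one.1 h
      exact (hz'.singleton_move o).twistedConj
  refine ⟨φ, ?_⟩
  have hcard : Nat.card (Quotient (twistedConjSetoid (orthogonalGroupAut n φ))) = 2 := by
    rw [Nat.card_eq_two_iff]
    refine ⟨Quotient.mk _ 1, Quotient.mk _ (signDiagonal F {o}), fun h => ?_, ?_⟩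
    · have h1 := det_eq_of_twistedConj (Quotient.exact h)
      rw [hD] at h1
      have : (1 : F) = -1 := by simpa using h1
      norm_num at this
    · rw [Set.eq_univ_iff_forall]
      intro c
      induction c using Quotient.inductionOn with
      | _ A => exact (hclass A).imp (fun h => Quotient.sound h) fun h => Quotient.sound h
  have : Finite (Quotient (twistedConjSetoid (orthogonalGroupAut n φ))) :=
    Nat.finite_of_card_ne_zero (by simp [hcard])
  rw [reidemeisterNumber, ENat.card_eq_coe_natCard, hcard]
  rfl
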